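/- Fix integers $m,n\ge 2$, put $N=m+n$. For $x_1,x_2,y_1,y_2\in\mathbb{R}^d$ let $$h(x_1,x_2;y_1,y_2)=\tfrac13-\tfrac1{2\pi}\mathsf{Ang}(x_1-y_1,x_2-y_1)-\tfrac1{2\pi}\mathsf{Ang}(y_1-x_1,y_2-x_1),$$ where $\mathsf{Ang}(u,v)=\arccos\{u^\top v/(\|u\|\|v\|)\}$ for nonzero $u,v$ (and, by convention, $\mathsf{Ang}(u,v)=\pi/2$ if $u=0$ or $v=0$). For samples $x_1,\dots,x_m$ and $y_1,\dots,y_n$ in $\mathbb{R}^d$ let $$U_{\mathrm{CvM}}=\frac{1}{m(m-1)n(n-1)}\sum_{i_1\ne i_2}\sum_{j_1\neq j_2}h(x_{i_1},x_{i_2};y_{j_1},y_{j_2}).$$ Let $(z_1,\dots,z_N)=(x_1,\dots,x_m,y_1,\dots,y_n)$ be the pooled sample and, for a permutation $\varpi$ of $\{1,\dots,N\}$, let $U^{\varpi}_{\mathrm{CvM}}$ be the statistic computed from the samples $z_{\varpi(1)},\dots,z_{\varpi(m)}$ and $z_{\varpi(m+1)},\dots,z_{\varpi(N)}$. For $0<\alpha<1$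 define the permutation critical value $$c_\alpha=\inf\Big\{t\in\mathbb{R}:\ 1-\alpha\le\frac1{N!}\sum_{\varpi}\mathbf 1(U^{\varpi}_{\mathrm{CvM}}\le t)\Big\}$$ and the permutation test $\phi_{\mathrm{CvM}}=\mathbf 1(U_{\mathrm{CvM}}>c_\alpha)$. **Theorem (HDLSS consistency).** For every dimension $d$ let $P_X=P_X^{(d)}$ and $P_Y=P_Y^{(d)}$ be probability measures on $\mathbb{R}^d$ with finite second moments, with means $\mu_X,\mu_Y$ and covariance matrices $\Sigma_X,\Sigma_Y$. Assume that, as $d\to\infty$: (A1) whenever $Z_1,Z_2,Z_3$ are independent and each $Z_i$ has law $P_X$ or $P_Y$ (in any combination), $\mathrm{Var}(\|Z_1-Z_2\|^2)=O(d)$ and $\mathrm{Var}\{(Z_1-Z_3)^\top(Z_2-Z_3)\}=O(d)$; (A2) $d^{-1}\mathrm{tr}(\Sigma_X)\to\overline\sigma_X^2$, $d^{-1}\mathrm{tr}(\Sigma_Y)\to\overline\sigma_Y^2$ and $d^{-1}\|\mu_X-\mu_Y\|^2\to\overline\delta_{XY}^2$, where $0<\overline\sigma_X^2,\overline\sigma_Y^2<\infty$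 and $0\le\overline\delta_{XY}^2<\infty$. Assume moreover that $\overline\sigma_X^2\ne\overline\sigma_Y^2$ or $\overline\delta_{XY}^2>0$. Let $0<\alpha<1$ satisfy $\alpha>1/\{(m+n)!/(m!\,n!)\}$ if $m\ne n$, and $\alpha>2/\{(m+n)!/(m!\,n!)\}$ if $m=n$. If, for each $d$, $X_1,\dots,X_m\sim P_X$ and $Y_1,\dots,Y_n\sim P_Y$ are mutually independent and $\phi_{\mathrm{CvM}}$ is computed from these samples, then, with $m,n,\alpha$ fixed, $$\lim_{d\to\infty}\mathbb{E}[\phi_{\mathrm{CvM}}]=1.$$ -/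

import Mathlib

open MeasureTheory ProbabilityTheory Filter Topology
open scoped NNReal ENNReal Nat

noncomputable section

namespace HDLSS

/-- `d`-dimensional real space with the Euclidean inner product and norm. -/
abbrev Vec (d : ℕ) : Type := EuclideanSpace ℝ (Fin d)

/-- The Cramér-von Mises kernel `h(x₁, x₂; y₁, y₂)`. The angle between two nonzero vectors is
`arccos (⟪u, v⟫ / (‖u‖ ‖v‖))`; it is `π / 2` by convention if one of them is zero. -/
def kernel {d : ℕ} (x₁ x₂ y₁ y₂ : Vec d) : ℝ :=
  1 / 3 - 1 / (2 * Real.pi) * InnerProductGeometry.angle (x₁ - y₁) (x₂ - y₁)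
    - 1 / (2 * Real.pi) * InnerProductGeometry.angle (y₁ - x₁) (y₂ - x₁)

/-- The two-sample U-statistic: the average of the kernel over all ordered pairs of distinct
indices of the first sample and all ordered pairs of distinct indices of the second sample. -/
def cvmStat {d m n : ℕ} (x : Fin m → Vec d) (y : Fin n → Vec d) : ℝ :=
  1 / ((m.descFactorial 2 : ℝ) * (n.descFactorial 2 : ℝ)) *
    ∑ i ∈ (Finset.univ : Finset (Fin m)).offDiag, ∑ j ∈ (Finset.univ : Finset (Fin n)).offDiag,
      kernel (x i.1) (x i.2) (y j.1) (y j.2)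

/-- The statistic of a pooled sample of size `m + n`, whose first `m` entries are taken as the first
sample and whose last `n` entries are taken as the second one. -/
def pooledStat {d : ℕ} (m n : ℕ) (z : Fin (m + n) → Vec d) : ℝ :=
  cvmStat (fun i : Fin m => z (Fin.castAdd n i)) (fun j : Fin n => z (Fin.natAdd m j))

/-- The permutation distribution function: the proportion of the permutations of the pooled sample
for which the statistic is at most `t`. -/
def permCdf {d m n : ℕ} (x : Fin m → Vec d) (y : Fin n → Vec d) (t : ℝ) : ℝ :=
  1 / ((m + n)! : ℝ) * ∑ ϖ : Equiv.Perm (Fin (m + n)),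
    Set.indicator {s : ℝ | s ≤ t} (fun _ => (1 : ℝ)) (pooledStat m n (Fin.append x y ∘ ϖ))

/-- The permutation critical value at level `α`. -/
def critValue {d m n : ℕ} (α : ℝ) (x : Fin m → Vec d) (y : Fin n → Vec d) : ℝ :=
  sInf {t : ℝ | 1 - α ≤ permCdf x y t}

/-- The permutation test: `1` (reject) if the statistic exceeds the critical value, else `0`. -/
def permTest {d m n : ℕ} (α : ℝ) (x : Fin m → Vec d) (y : Fin n → Vec d) : ℝ :=
  Set.indicator {s : ℝ | critValue α x y < s} (fun _ => (1 : ℝ)) (cvmStat x y)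

/-- The mean vector of a law on `ℝᵈ`. -/
def meanVec {d : ℕ} (P : Measure (Vec d)) : Vec d := ∫ x, x ∂P

/-- The covariance matrix of a law on `ℝᵈ`. -/
def covMat {d : ℕ} (P : Measure (Vec d)) : Matrix (Fin d) (Fin d) ℝ :=
  Matrix.of fun i j => cov[fun x : Vec d => x i, fun x : Vec d => x j; P]

/-- Weak dependence: for independent `Z₁, Z₂, Z₃`, each distributed according to one of the two
populations, `Var ‖Z₁ - Z₂‖² = O(d)` and `Var ((Z₁ - Z₃)ᵀ (Z₂ - Z₃)) = O(d)` as `d → ∞`.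
The variances are taken in `[0, ∞]`, so that the bound includes their finiteness. -/
def WeakDependence (PX PY : ∀ d : ℕ, Measure (Vec d)) : Prop :=
  ∀ Q₁ ∈ ({PX, PY} : Set (∀ d : ℕ, Measure (Vec d))),
  ∀ Q₂ ∈ ({PX, PY} : Set (∀ d : ℕ, Measure (Vec d))),
    (∃ C : ℝ≥0, ∀ᶠ d : ℕ in atTop,
      evariance (fun z : Vec d × Vec d => ‖z.1 - z.2‖ ^ 2) ((Q₁ d).prod (Q₂ d))
        ≤ (C : ℝ≥0∞) * (d : ℝ≥0∞)) ∧
    ∀ Q₃ ∈ ({PX, PY} : Set (∀ d : ℕ, Measure (Vec d))),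
      ∃ C : ℝ≥0, ∀ᶠ d : ℕ in atTop,
        evariance (fun z : Vec d × Vec d × Vec d => inner ℝ (z.1 - z.2.2) (z.2.1 - z.2.2))
          ((Q₁ d).prod ((Q₂ d).prod (Q₃ d))) ≤ (C : ℝ≥0∞) * (d : ℝ≥0∞)

/-- Limits of the normalised total variances and of the normalised squared mean difference;
`sX`, `sY`, `δ` stand for the limits themselves (squared scales and squared distance). -/
def ScaleLimits (PX PY : ∀ d : ℕ, Measure (Vec d)) (sX sY δ : ℝ) : Prop :=
  Tendsto (fun d : ℕ => (covMat (PX d)).trace / (d : ℝ)) atTop (𝓝 sX) ∧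
  Tendsto (fun d : ℕ => (covMat (PY d)).trace / (d : ℝ)) atTop (𝓝 sY) ∧
  Tendsto (fun d : ℕ => ‖meanVec (PX d) - meanVec (PY d)‖ ^ 2 / (d : ℝ)) atTop (𝓝 δ) ∧
  0 < sX ∧ 0 < sY ∧ 0 ≤ δ

end HDLSS

end

namespace HDLSS

/-! In high dimension the geometry of the pooled sample becomes deterministic. By Chebyshev, every
inner product of differences, divided by `d`, concentrates at a constant depending only on which
populations the points come from (`tendsto_measure_gram`). Angles are continuous functions of this
array near its limit, so the statistic of each permutation is close to a number `limStat` determined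
by the permuted labels.

The heart is the deterministic inequality `limStat_lt`: as soon as both samples contain points of a
common population, the limit is strictly smaller than that of the true labelling. An angle between
points of different populations is at least the mean of the two angles between points of equal
populations (`limAngle_diag_le`). This reduces the sum of angles to pair terms `limPair p q`, which
equal `2π/3` when `p = q` and are strictly smaller otherwise (`limAngle_diag_add_lt`); strictness is
where a difference in scale or location enters.

Hence, with probability tending to one, only separating permutations can reach the observed
statistic. There are at most `m! n!` of them, or twice that when `m = n` (`card_separating_le`), a
proportion at most `α`; so the critical value lies strictly below the statistic
(`critValue_lt_cvmStat`). -/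

/-! ### Two trigonometric inequalities -/

/-- With `p`, `q` the two angles, `u + v = 2 cos((p+q)/2) cos((p-q)/2)`. If `p + q ≥ 2π/3` the first
cosine is at most `1/2`, which forces `u + v = 1` and `p = q`, the case excluded by `hne`. -/
theorem arccos_add_arccos_lt {u v : ℝ} (hu : 0 < u) (hv : 0 < v) (huv : 1 ≤ u + v)
    (hne : u ≠ v ∨ 1 < u + v) (hu1 : u ≤ 1) (hv1 : v ≤ 1) :
    Real.arccos u + Real.arccos v < 2 * Real.pi / 3 := by
  by_contra! h
  have hp := Real.cos_arccos (by linarith) hu1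
  have hq := Real.cos_arccos (by linarith) hv1
  have hp1 : Real.arccos u < Real.pi / 2 := by
    rw [Real.arccos_lt_pi_div_two]; exact hu
  have hq1 : Real.arccos v < Real.pi / 2 := by
    rw [Real.arccos_lt_pi_div_two]; exact hv
  have hp0 := Real.arccos_nonneg u
  have hq0 := Real.arccos_nonneg v
  generalize Real.arccos u = p at *
  generalize Real.arccos v = q at *
  have hs : u + v = 2 * Real.cos ((p + q) / 2) * Real.cos ((p - q) / 2) := by
    rw [← hp, ← hq, Real.cos_add_cos]
  have hpi := Real.pi_pos
  have h1 : Real.cos ((p + q) / 2) ≤ 1 / 2 := by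
    rw [← Real.cos_pi_div_three]
    exact Real.cos_le_cos_of_nonneg_of_le_pi (by positivity) (by linarith) (by linarith)
  have h0 : 0 ≤ Real.cos ((p + q) / 2) :=
    Real.cos_nonneg_of_mem_Icc ⟨by linarith, by linarith⟩
  have h2 := Real.cos_le_one ((p - q) / 2)
  have h3 : Real.cos ((p - q) / 2) = 1 ∧ u + v ≤ 1 := by
    have h4 : 0 ≤ Real.cos ((p - q) / 2) :=
      Real.cos_nonneg_of_mem_Icc ⟨by linarith, by linarith⟩
    have h5 := mul_le_mul_of_nonneg_right h1 h4
    constructor <;> linarith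
  rcases hne with hne | hne
  · have h4 := (Real.cos_eq_one_iff_of_lt_of_lt (by linarith) (by linarith)).1 h3.1
    exact hne (by rw [← hp, ← hq, show p = q by linarith])
  · linarith [h3.2]

theorem pi_div_three_add_arccos_le {r : ℝ} (hr : 0 ≤ r) (hr1 : r ≤ 1) :
    Real.pi / 3 + Real.arccos r ≤ 2 * Real.arccos √(r / 2) := by
  have hpi := Real.pi_pos
  have hx : √(r / 2) ≤ 1 := Real.sqrt_le_one.2 (by linarith)
  have hA := Real.cos_arccos (by linarith [Real.sqrt_nonneg (r / 2)]) hx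
  have hA1 : Real.arccos √(r / 2) ≤ Real.pi / 2 := by
    rw [Real.arccos_le_pi_div_two]; positivity
  have hA0 := Real.arccos_nonneg √(r / 2)
  have hB1 : Real.arccos r ≤ Real.pi / 2 := by
    rw [Real.arccos_le_pi_div_two]; exact hr
  have hB0 := Real.arccos_nonneg r
  have hcos : Real.cos (2 * Real.arccos √(r / 2)) = r - 1 := by
    rw [Real.cos_two_mul, hA, Real.sq_sqrt (by positivity)]; ring
  by_contra! h
  have := Real.cos_lt_cos_of_nonneg_of_le_pi (by linarith) (by linarith) h
  rw [hcos, Real.cos_add, Real.cos_arccos (by linarith) hr1, Real.sin_arccos,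
    Real.cos_pi_div_three, Real.sin_pi_div_three] at this
  have h3 : √3 / 2 * √(1 - r ^ 2) ≤ 1 - r / 2 := by
    rw [div_mul_eq_mul_div, ← Real.sqrt_mul (by norm_num), div_le_iff₀ (by norm_num)]
    refine Real.sqrt_le_iff.2 ⟨by linarith, ?_⟩
    -- The difference `(2 - r)² - 3 (1 - r²)` is the square `(1 - 2r)²`.
    nlinarith [sq_nonneg (1 - 2 * r)]
  linarith

/-! ### Limiting angles and the limiting statistic -/

/-- The limit of `‖Z - Z'‖² / d` for independent `Z`, `Z'` from the populations `p`, `q`. -/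
noncomputable def limSq (s : Bool → ℝ) (δ : ℝ) (p q : Bool) : ℝ := s p + s q + if p = q then 0 else δ

/-- The limit of `⟪Z₁ - Z₃, Z₂ - Z₃⟫ / d` for independent `Z₁`, `Z₂`, `Z₃` from the populations
`p`, `q`, `v`. -/
noncomputable def limInner (s : Bool → ℝ) (δ : ℝ) (p q v : Bool) : ℝ :=
  s v + if p ≠ v ∧ q ≠ v then δ else 0

/-- The limit of the angle at the vertex `Z₃` of the triangle `Z₁`, `Z₂`, `Z₃`. -/
noncomputable def limAngle (s : Bool → ℝ) (δ : ℝ) (p q v : Bool) : ℝ :=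
  Real.arccos (limInner s δ p q v / (√(limSq s δ p v) * √(limSq s δ q v)))

/-- Three independent points of one population are asymptotically equidistant, so they span an
equilateral triangle. -/
theorem limAngle_self_self {s : Bool → ℝ} (hs : ∀ b, 0 < s b) (δ : ℝ) (v : Bool) :
    limAngle s δ v v v = Real.pi / 3 := by
  have := hs v
  have h : limInner s δ v v v / (√(limSq s δ v v) * √(limSq s δ v v)) = 1 / 2 := by
    rw [Real.mul_self_sqrt] <;> simp [limInner, limSq]
    · field_simp; norm_num
    · linarith
  rw [limAngle, h, ← Real.cos_pi_div_three, Real.arccos_cos] <;> linarith [Real.pi_pos]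

theorem limSq_pos {s : Bool → ℝ} (hs : ∀ b, 0 < s b) {δ : ℝ} (hδ : 0 ≤ δ) (p q : Bool) :
    0 < limSq s δ p q := by
  have := hs p; have := hs q
  unfold limSq; split_ifs <;> linarith

theorem limAngle_diag_of_ne {s : Bool → ℝ} (hs : ∀ b, 0 < s b) {δ : ℝ} (hδ : 0 ≤ δ)
    {p v : Bool} (h : p ≠ v) :
    limAngle s δ p p v = Real.arccos ((s v + δ) / (s p + s v + δ)) := by
  rw [limAngle, Real.mul_self_sqrt (limSq_pos hs hδ _ _).le]
  simp [limInner, limSq, h]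

theorem limAngle_comm (s : Bool → ℝ) (δ : ℝ) (p q v : Bool) :
    limAngle s δ p q v = limAngle s δ q p v := by
  unfold limAngle limInner
  simp only [mul_comm, and_comm]

/-- With `r = s v / (s p + s v + δ)` the mixed angle is `arccos √(r/2)`, and
`pi_div_three_add_arccos_le` applies. The `δ` in the numerator of the cosine for `p, p` only
decreases that angle. -/
theorem limAngle_diag_le_of_ne {s : Bool → ℝ} (hs : ∀ b, 0 < s b) {δ : ℝ} (hδ : 0 ≤ δ)
    {p v : Bool} (h : p ≠ v) :
    (limAngle s δ p p v + limAngle s δ v v v) / 2 ≤ limAngle s δ p v v := by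
  have hv := hs v
  have hp := hs p
  have hT : 0 < s p + s v + δ := by linarith
  have hr : limInner s δ p v v / (√(limSq s δ p v) * √(limSq s δ v v))
      = √(s v / (s p + s v + δ) / 2) := by
    rw [eq_comm, ← Real.sqrt_mul (limSq_pos hs hδ _ _).le,
      Real.sqrt_eq_iff_mul_self_eq (by positivity)
        (div_nonneg (by simp [limInner, hv.le]) (Real.sqrt_nonneg _)),
      div_mul_div_comm, Real.mul_self_sqrt
        (mul_pos (limSq_pos hs hδ _ _) (limSq_pos hs hδ _ _)).le]
    simp only [limInner, limSq, h, if_true, if_false, ne_eq, not_true, and_false, add_zero]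
    field_simp
    norm_num
  have key := pi_div_three_add_arccos_le (r := s v / (s p + s v + δ)) (by positivity)
    (by rw [div_le_one hT]; linarith)
  have mono : Real.arccos ((s v + δ) / (s p + s v + δ)) ≤ Real.arccos (s v / (s p + s v + δ)) :=
    Real.arccos_le_arccos (by gcongr; linarith)
  rw [limAngle_self_self hs, limAngle_diag_of_ne hs hδ h, limAngle, hr]
  linarith

theorem limAngle_diag_le {s : Bool → ℝ} (hs : ∀ b, 0 < s b) {δ : ℝ} (hδ : 0 ≤ δ)
    (p q v : Bool) :
    (limAngle s δ p p v + limAngle s δ q q v) / 2 ≤ limAngle s δ p q v := by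
  by_cases hpq : p = q
  · subst hpq; linarith
  by_cases hq : q = v
  · subst hq; exact limAngle_diag_le_of_ne hs hδ hpq
  · have hp : p = v := by revert p q v; decide
    subst hp
    rw [limAngle_comm s δ p q, add_comm]
    exact limAngle_diag_le_of_ne hs hδ hq

/-- The two cosines add up to `1 + δ / (s true + s false + δ)` and differ when the scales do, so
`hdiff` supplies the strictness condition of `arccos_add_arccos_lt`. -/
theorem limAngle_diag_add_lt {s : Bool → ℝ} (hs : ∀ b, 0 < s b) {δ : ℝ} (hδ : 0 ≤ δ)
    (hdiff : s true ≠ s false ∨ 0 < δ) :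
    limAngle s δ true true false + limAngle s δ false false true < 2 * Real.pi / 3 := by
  have ht := hs true
  have hf := hs false
  have hT : 0 < s true + s false + δ := by linarith
  rw [limAngle_diag_of_ne hs hδ (by decide), limAngle_diag_of_ne hs hδ (by decide),
    add_comm (s false) (s true)]
  have e : (s false + δ) / (s true + s false + δ) + (s true + δ) / (s true + s false + δ)
      = 1 + δ / (s true + s false + δ) := by field_simp; ring
  apply arccos_add_arccos_lt (by positivity) (by positivity)
  · rw [e]; linarith [div_nonneg hδ hT.le]
  · rcases hdiff with h | h
    · left
      intro hh
      field_simp at hh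
      exact h (by linarith)
    · right
      rw [e]; linarith [div_pos h hT]
  · rw [div_le_one hT]; linarith
  · rw [div_le_one hT]; linarith

/-- The symmetrised pair of limiting angles between a point with label `p` and one with
label `q`. -/
noncomputable def limPair (s : Bool → ℝ) (δ : ℝ) (p q : Bool) : ℝ := limAngle s δ p p q + limAngle s δ q q p

theorem limPair_true_false_le {s : Bool → ℝ} (hs : ∀ b, 0 < s b) {δ : ℝ} (hδ : 0 ≤ δ)
    (hdiff : s true ≠ s false ∨ 0 < δ) (p q : Bool) :
    limPair s δ true false ≤ limPair s δ p q := by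
  have h := limAngle_diag_add_lt hs hδ hdiff
  cases p <;> cases q <;> simp only [limPair, limAngle_self_self hs] <;> linarith

theorem limPair_true_false_lt {s : Bool → ℝ} (hs : ∀ b, 0 < s b) {δ : ℝ} (hδ : 0 ≤ δ)
    (hdiff : s true ≠ s false ∨ 0 < δ) (p : Bool) :
    limPair s δ true false < limPair s δ p p := by
  have h := limAngle_diag_add_lt hs hδ hdiff
  cases p <;> simp only [limPair, limAngle_self_self hs] <;> linarith

theorem sum_offDiag_swap {ι : Type*} [Fintype ι] [DecidableEq ι] (f : ι × ι → ℝ) :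
    ∑ i ∈ (Finset.univ : Finset ι).offDiag, f i.swap
      = ∑ i ∈ (Finset.univ : Finset ι).offDiag, f i := by
  refine Finset.sum_equiv (Equiv.prodComm ι ι) (fun i => ?_) (fun i _ => rfl)
  simp [eq_comm]

/-- Sum `limAngle_diag_le` over ordered pairs; by the swap symmetry both halves of the mean
contribute the same total. -/
theorem sum_limAngle_ge {s : Bool → ℝ} (hs : ∀ b, 0 < s b) {δ : ℝ} (hδ : 0 ≤ δ)
    {ι : Type*} [Fintype ι] [DecidableEq ι] (a : ι → Bool) (v : Bool) :
    ∑ i ∈ (Finset.univ : Finset ι).offDiag, limAngle s δ (a i.1) (a i.1) v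
      ≤ ∑ i ∈ (Finset.univ : Finset ι).offDiag, limAngle s δ (a i.1) (a i.2) v := by
  have h := sum_offDiag_swap (fun i : ι × ι => limAngle s δ (a i.1) (a i.1) v)
  have h2 : ∑ i ∈ (Finset.univ : Finset ι).offDiag,
      (limAngle s δ (a i.1) (a i.1) v + limAngle s δ (a i.2) (a i.2) v) / 2
      ≤ ∑ i ∈ (Finset.univ : Finset ι).offDiag, limAngle s δ (a i.1) (a i.2) v :=
    Finset.sum_le_sum fun i _ => limAngle_diag_le hs hδ _ _ _
  rw [← Finset.sum_div, Finset.sum_add_distrib] at h2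
  simp only [Prod.fst_swap] at h
  linarith

/-- The limit of the kernel for points with labels `p₁`, `p₂`; `q₁`, `q₂`. -/
noncomputable def limKernel (s : Bool → ℝ) (δ : ℝ) (p₁ p₂ q₁ q₂ : Bool) : ℝ :=
  1 / 3 - 1 / (2 * Real.pi) * limAngle s δ p₁ p₂ q₁
    - 1 / (2 * Real.pi) * limAngle s δ q₁ q₂ p₁

/-- The limit of the statistic for samples with labels `a` and `b`. -/
noncomputable def limStat (s : Bool → ℝ) (δ : ℝ) {m n : ℕ} (a : Fin m → Bool) (b : Fin n → Bool) : ℝ :=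
  1 / ((m.descFactorial 2 : ℝ) * (n.descFactorial 2 : ℝ)) *
    ∑ i ∈ (Finset.univ : Finset (Fin m)).offDiag, ∑ j ∈ (Finset.univ : Finset (Fin n)).offDiag,
      limKernel s δ (a i.1) (a i.2) (b j.1) (b j.2)

theorem limStat_lt {s : Bool → ℝ} (hs : ∀ b, 0 < s b) {δ : ℝ} (hδ : 0 ≤ δ)
    (hdiff : s true ≠ s false ∨ 0 < δ) {m n : ℕ} (hm : 2 ≤ m) (hn : 2 ≤ n)
    (a : Fin m → Bool) (b : Fin n → Bool) {i₀ : Fin m} {j₀ : Fin n} (h₀ : a i₀ = b j₀) :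
    limStat s δ a b < limStat s δ (fun _ : Fin m => true) (fun _ : Fin n => false) := by
  have hpi := Real.pi_pos
  unfold limStat
  have hm' : 0 < m.descFactorial 2 := Nat.descFactorial_pos.2 hm
  have hn' : 0 < n.descFactorial 2 := Nat.descFactorial_pos.2 hn
  refine mul_lt_mul_of_pos_left ?_ (by positivity)
  have e : ∀ p₁ p₂ q₁ q₂, limKernel s δ p₁ p₂ q₁ q₂ = 1 / 3 - 1 / (2 * Real.pi) *
      (limAngle s δ p₁ p₂ q₁ + limAngle s δ q₁ q₂ p₁) := by
    intros; unfold limKernel; ring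
  simp only [e, Finset.sum_sub_distrib, ← Finset.mul_sum]
  refine sub_lt_sub_left (mul_lt_mul_of_pos_left ?_ (by positivity)) _
  have : Nontrivial (Fin m) := Fin.nontrivial_iff_two_le.2 hm
  have : Nontrivial (Fin n) := Fin.nontrivial_iff_two_le.2 hn
  -- Partners are needed because the sums run over off-diagonal pairs; one strict term, at `(i₀,
  -- i₁)` and `(j₀, j₁)`, is enough.
  obtain ⟨i₁, hi₁⟩ := exists_ne i₀
  obtain ⟨j₁, hj₁⟩ := exists_ne j₀
  have hi : (i₀, i₁) ∈ (Finset.univ : Finset (Fin m)).offDiag := by simp [hi₁.symm]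
  have hj : (j₀, j₁) ∈ (Finset.univ : Finset (Fin n)).offDiag := by simp [hj₁.symm]
  calc _ = ∑ i ∈ (Finset.univ : Finset (Fin m)).offDiag,
        ∑ j ∈ (Finset.univ : Finset (Fin n)).offDiag, limPair s δ true false := rfl
    _ < ∑ i ∈ (Finset.univ : Finset (Fin m)).offDiag,
        ∑ j ∈ (Finset.univ : Finset (Fin n)).offDiag, limPair s δ (a i.1) (b j.1) := by
        refine Finset.sum_lt_sum (fun i _ => Finset.sum_le_sum fun j _ =>
          limPair_true_false_le hs hδ hdiff _ _) ⟨_, hi, Finset.sum_lt_sum (fun j _ =>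
          limPair_true_false_le hs hδ hdiff _ _) ⟨_, hj, ?_⟩⟩
        simp only [← h₀]
        exact limPair_true_false_lt hs hδ hdiff _
    _ ≤ _ := by
        simp only [limPair, Finset.sum_add_distrib]
        refine add_le_add ?_ (Finset.sum_le_sum fun i _ => sum_limAngle_ge hs hδ b _)
        -- For angles at vertices of the second sample, the vertex must be fixed in the outer sum.
        rw [Finset.sum_comm, Finset.sum_comm (s := (Finset.univ : Finset (Fin m)).offDiag)]
        exact Finset.sum_le_sum fun j _ => sum_limAngle_ge hs hδ a _

/-! ### Counting the separating permutations -/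

/-- A permutation mapping the left block into itself is, by finiteness, a pair of permutations of
the two blocks. -/
theorem card_perm_forall_isLeft_le (m n : ℕ) :
    (Finset.univ.filter fun σ : Equiv.Perm (Fin m ⊕ Fin n) =>
      ∀ i, (σ (Sum.inl i)).isLeft = true).card ≤ m ! * n ! := by
  classical
  calc _ ≤ (Finset.univ.image (Equiv.Perm.sumCongrHom (Fin m) (Fin n))).card := by
        refine Finset.card_le_card fun σ hσ => ?_
        obtain ⟨p, hp⟩ := Equiv.Perm.mem_sumCongrHom_range_of_perm_mapsTo_inl (σ := σ) (by
          rintro _ ⟨i, rfl⟩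
          obtain ⟨k, hk⟩ := Sum.isLeft_iff.1 ((Finset.mem_filter.1 hσ).2 i)
          exact ⟨k, hk.symm⟩)
        exact Finset.mem_image.2 ⟨p, Finset.mem_univ _, hp⟩
    _ ≤ _ := Finset.card_image_le.trans (by simp [Fintype.card_perm])

theorem card_perm_forall_isRight_le (n : ℕ) :
    (Finset.univ.filter fun σ : Equiv.Perm (Fin n ⊕ Fin n) =>
      ∀ i, (σ (Sum.inl i)).isLeft = false).card ≤ n ! * n ! := by
  refine le_trans ?_ (card_perm_forall_isLeft_le n n)
  refine Finset.card_le_card_of_injOn (fun σ => σ.trans (Equiv.sumComm _ _)) ?_ ?_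
  · intro σ hσ
    simpa using hσ
  · intro σ _ τ _ h
    ext1 x
    exact (Equiv.sumComm _ _).injective (Equiv.congr_fun h x)

/-- One point of the second sample decides the label of the whole first sample. If the blocks are
exchanged, `σ` injects each into the other, hence `m = n`. -/
theorem isLeft_or_eq_of_separated {m n : ℕ} (σ : Equiv.Perm (Fin m ⊕ Fin n))
    (hn : 0 < n) (h : ∀ i j, (σ (Sum.inl i)).isLeft ≠ (σ (Sum.inr j)).isLeft) :
    (∀ i, (σ (Sum.inl i)).isLeft = true) ∨
      (m = n ∧ ∀ i, (σ (Sum.inl i)).isLeft = false) := by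
  by_cases hj : (σ (Sum.inr ⟨0, hn⟩)).isLeft = false
  · left
    intro i
    have := h i ⟨0, hn⟩
    rw [hj] at this
    simpa using this
  right
  have hl : ∀ i, (σ (Sum.inl i)).isLeft = false := by
    intro i
    have := h i ⟨0, hn⟩
    simp only [Bool.not_eq_false] at hj
    rw [hj] at this
    simpa using this
  refine ⟨le_antisymm ?_ ?_, hl⟩
  · have : ∀ i, ∃ k, σ (Sum.inl i) = Sum.inr k := fun i =>
      Sum.isRight_iff.1 (by simpa using hl i)
    choose f hf using this
    have hinj : Function.Injective f := fun i i' hi => by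
      have : σ (Sum.inl i) = σ (Sum.inl i') := by rw [hf, hf, hi]
      exact Sum.inl_injective (σ.injective this)
    simpa using Fintype.card_le_of_injective f hinj
  · rcases Nat.eq_zero_or_pos m with hm | hm
    · subst hm
      have : ∀ k : Fin n, ∃ k', σ (Sum.inr k') = Sum.inr k := fun k => by
        obtain ⟨x, hx⟩ := σ.surjective (Sum.inr k)
        rcases x with x | x
        · exact x.elim0
        · exact ⟨x, hx⟩
      simp only [Bool.not_eq_false] at hj
      obtain ⟨k, -⟩ := Sum.isLeft_iff.1 hj
      exact k.elim0
    have : ∀ j, ∃ k, σ (Sum.inr j) = Sum.inl k := fun j => by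
      refine Sum.isLeft_iff.1 ?_
      have := h ⟨0, hm⟩ j
      rw [hl] at this
      simpa using this.symm
    choose f hf using this
    have hinj : Function.Injective f := fun i i' hi => by
      have : σ (Sum.inr i) = σ (Sum.inr i') := by rw [hf, hf, hi]
      exact Sum.inr_injective (σ.injective this)
    simpa using Fintype.card_le_of_injective f hinj

/-- The population of an index of the pooled sample: `true` for the first sample. -/
def label (m n : ℕ) (k : Fin (m + n)) : Bool := (finSumFinEquiv.symm k).isLeft

@[simp] theorem label_castAdd (m n : ℕ) (i : Fin m) : label m n (Fin.castAdd n i) = true := by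
  simp [label]

@[simp] theorem label_natAdd (m n : ℕ) (j : Fin n) : label m n (Fin.natAdd m j) = false := by
  simp [label]

/-- The permutations for which every point assigned to the first sample and every point assigned
to the second one come from different populations. -/
def separating (m n : ℕ) : Finset (Equiv.Perm (Fin (m + n))) :=
  Finset.univ.filter fun ϖ => ∀ i j,
    label m n (ϖ (Fin.castAdd n i)) ≠ label m n (ϖ (Fin.natAdd m j))

theorem card_separating_le {m n : ℕ} (hn : 0 < n) :
    (separating m n).card ≤ if m = n then 2 * (m ! * n !) else m ! * n ! := by
  classical
  have h1 : (separating m n).card ≤ (Finset.univ.filter fun σ : Equiv.Perm (Fin m ⊕ Fin n) =>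
      (∀ i, (σ (Sum.inl i)).isLeft = true) ∨
        (m = n ∧ ∀ i, (σ (Sum.inl i)).isLeft = false)).card := by
    refine Finset.card_le_card_of_injOn (fun ϖ => finSumFinEquiv.symm.permCongr ϖ) ?_
      (finSumFinEquiv.symm.permCongr.injective.injOn)
    intro ϖ hϖ
    simp only [Finset.coe_filter, Finset.mem_univ, true_and, Set.mem_ofPred_eq]
    apply isLeft_or_eq_of_separated _ hn
    intro i j
    simpa [separating, label] using (Finset.mem_filter.1 hϖ).2 i j
  refine h1.trans ?_
  rw [Finset.filter_or]
  refine (Finset.card_union_le _ _).trans ?_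
  split_ifs with h
  · subst h
    have := card_perm_forall_isLeft_le m m
    have := card_perm_forall_isRight_le m
    simp only [true_and]
    omega
  · simpa [h] using card_perm_forall_isLeft_le m n

/-! ### Critical value and measurability of the test -/

section Test

variable {d m n : ℕ} {α : ℝ} (x : Fin m → Vec d) (y : Fin n → Vec d)

theorem permCdf_mono : Monotone (permCdf x y) := by
  intro s t hst
  unfold permCdf
  gcongr

theorem le_permCdf {t : ℝ} (B : Finset (Equiv.Perm (Fin (m + n))))
    (h : ∀ ϖ ∉ B, pooledStat m n (Fin.append x y ∘ ϖ) ≤ t) :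
    1 - (B.card : ℝ) / (m + n)! ≤ permCdf x y t := by
  classical
  have hN : (0 : ℝ) < (m + n)! := by positivity
  have h1 : ∑ ϖ : Equiv.Perm (Fin (m + n)), (1 - if ϖ ∈ B then (1 : ℝ) else 0) ≤
      ∑ ϖ : Equiv.Perm (Fin (m + n)),
        Set.indicator {s : ℝ | s ≤ t} (fun _ => (1 : ℝ)) (pooledStat m n (Fin.append x y ∘ ϖ)) := by
    refine Finset.sum_le_sum fun ϖ _ => ?_
    by_cases hB : ϖ ∈ B
    · simpa [hB] using Set.indicator_nonneg (fun _ _ => zero_le_one) _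
    · simp [hB, Set.indicator, h ϖ hB]
  rw [Finset.sum_sub_distrib] at h1
  simp only [Finset.sum_const, Finset.card_univ, Fintype.card_perm, Fintype.card_fin,
    nsmul_eq_mul, mul_one, Finset.sum_ite_mem, Finset.univ_inter] at h1
  unfold permCdf
  rw [one_div_mul_eq_div, le_div_iff₀ hN]
  refine le_trans (le_of_eq ?_) h1
  rw [sub_mul, div_mul_cancel₀ _ hN.ne', one_mul]

/-- The real `sInf` has its intended meaning only on a nonempty set bounded below: above all
permuted statistics the distribution function is `1`, below them it is `0 < 1 - α`. -/
theorem critValue_lt_iff (h0 : 0 ≤ α) (h1 : α < 1) {u : ℝ} :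
    critValue α x y < u ↔ ∃ t < u, 1 - α ≤ permCdf x y t := by
  obtain ⟨T, hT⟩ : ∃ T, ∀ ϖ : Equiv.Perm (Fin (m + n)),
      pooledStat m n (Fin.append x y ∘ ϖ) ≤ T := by
    obtain ⟨T, hT⟩ := (Set.finite_range fun ϖ : Equiv.Perm (Fin (m + n)) =>
      pooledStat m n (Fin.append x y ∘ ϖ)).bddAbove
    exact ⟨T, fun ϖ => hT ⟨ϖ, rfl⟩⟩
  obtain ⟨T', hT'⟩ : ∃ T, ∀ ϖ : Equiv.Perm (Fin (m + n)),
      T ≤ pooledStat m n (Fin.append x y ∘ ϖ) := by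
    obtain ⟨T, hT⟩ := (Set.finite_range fun ϖ : Equiv.Perm (Fin (m + n)) =>
      pooledStat m n (Fin.append x y ∘ ϖ)).bddBelow
    exact ⟨T, fun ϖ => hT ⟨ϖ, rfl⟩⟩
  have hne : {t : ℝ | 1 - α ≤ permCdf x y t}.Nonempty := by
    refine ⟨T, ?_⟩
    have := le_permCdf x y ∅ fun ϖ _ => hT ϖ
    simp only [Finset.card_empty, Nat.cast_zero, zero_div, sub_zero] at this
    exact (sub_le_self _ h0).trans this
  have hbdd : BddBelow {t : ℝ | 1 - α ≤ permCdf x y t} := by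
    refine ⟨T', fun t ht => ?_⟩
    by_contra! hlt
    have : permCdf x y t = 0 := by
      unfold permCdf
      rw [Finset.sum_eq_zero, mul_zero]
      intro ϖ _
      simp [Set.indicator, hlt.trans_le (hT' ϖ)]
    rw [Set.mem_ofPred_eq, this] at ht
    linarith
  unfold critValue
  rw [csInf_lt_iff hbdd hne]
  exact ⟨fun ⟨t, h, h'⟩ => ⟨t, h', h⟩, fun ⟨t, h, h'⟩ => ⟨t, h', h⟩⟩

theorem critValue_lt_cvmStat (hn : 0 < n) (h1 : α < 1)
    (hα : ((if m = n then 2 * (m ! * n !) else m ! * n ! : ℕ) : ℝ) / (m + n)! ≤ α)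
    (h : ∀ ϖ ∉ separating m n, pooledStat m n (Fin.append x y ∘ ϖ) < cvmStat x y) :
    critValue α x y < cvmStat x y := by
  have h0 : 0 ≤ α := le_trans (by positivity) hα
  rw [critValue_lt_iff x y h0 h1]
  have hev : ∀ᶠ t in 𝓝[<] cvmStat x y, ∀ ϖ : Equiv.Perm (Fin (m + n)),
      ϖ ∉ separating m n → pooledStat m n (Fin.append x y ∘ ϖ) ≤ t := by
    -- There are finitely many permutations, so one `t` strictly below the statistic dominates every
    -- non-separating value.
    refine eventually_all.2 fun ϖ => ?_
    by_cases hϖ : ϖ ∈ separating m n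
    · simp [hϖ]
    · filter_upwards [mem_nhdsWithin_of_mem_nhds (Ioi_mem_nhds (h ϖ hϖ))] with t ht _ using le_of_lt ht
  obtain ⟨t, ht, hlt⟩ := (hev.and self_mem_nhdsWithin).exists
  refine ⟨t, hlt, le_trans ?_ (le_permCdf x y _ ht)⟩
  refine sub_le_sub_left (le_trans ?_ hα) _
  gcongr
  exact card_separating_le hn

theorem measurable_kernel {β : Type*} [MeasurableSpace β] {f g u v : β → Vec d}
    (hf : Measurable f) (hg : Measurable g) (hu : Measurable u) (hv : Measurable v) :
    Measurable fun b => kernel (f b) (g b) (u b) (v b) := by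
  have key : ∀ f g : β → Vec d, Measurable f → Measurable g →
      Measurable fun z => InnerProductGeometry.angle (f z) (g z) := fun f g hf hg =>
    Real.continuous_arccos.measurable.comp ((hf.inner hg).div (hf.norm.mul hg.norm))
  unfold kernel
  exact (measurable_const.sub ((key _ _ (hf.sub hu) (hg.sub hu)).const_mul _)).sub
    ((key _ _ (hu.sub hf) (hv.sub hf)).const_mul _)

theorem measurable_pooledStat : Measurable fun z : Fin (m + n) → Vec d => pooledStat m n z := by
  unfold pooledStat cvmStat
  refine Measurable.const_mul (Finset.measurable_sum _ fun i _ =>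
    Finset.measurable_sum _ fun j _ => ?_) _
  exact measurable_kernel (measurable_pi_apply _) (measurable_pi_apply _) (measurable_pi_apply _)
    (measurable_pi_apply _)

theorem pooledStat_append : pooledStat m n (Fin.append x y) = cvmStat x y := by
  simp [pooledStat]

/-- The rejection region of the permutation test, as a set of pooled samples. -/
def rejectionRegion (d m n : ℕ) (α : ℝ) : Set (Fin (m + n) → Vec d) :=
  {z | critValue α (fun i => z (Fin.castAdd n i)) (fun j => z (Fin.natAdd m j))
    < cvmStat (fun i => z (Fin.castAdd n i)) (fun j => z (Fin.natAdd m j))}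

theorem measurableSet_rejectionRegion (h0 : 0 ≤ α) (h1 : α < 1) :
    MeasurableSet (rejectionRegion d m n α) := by
  -- Monotonicity of `permCdf` allows the threshold to be rational, giving a countable union.
  have e : rejectionRegion d m n α = ⋃ q : ℚ, {z | (q : ℝ) < pooledStat m n z ∧
      1 - α ≤ permCdf (fun i => z (Fin.castAdd n i)) (fun j => z (Fin.natAdd m j)) q} := by
    ext z
    simp only [rejectionRegion, Set.mem_ofPred_eq, critValue_lt_iff _ _ h0 h1, Set.mem_iUnion]
    constructor
    · rintro ⟨t, ht, h⟩
      obtain ⟨q, hq, hq'⟩ := exists_rat_btwn ht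
      exact ⟨q, hq', h.trans (permCdf_mono _ _ hq.le)⟩
    · rintro ⟨q, hq, h⟩
      exact ⟨q, hq, h⟩
  rw [e]
  refine MeasurableSet.iUnion fun q => ?_
  rw [Set.ofPred_and]
  refine (measurableSet_lt measurable_const measurable_pooledStat).inter
    (measurableSet_le measurable_const ?_)
  unfold permCdf
  refine Measurable.const_mul (Finset.measurable_sum _ fun ϖ _ => ?_) _
  refine (measurable_const.indicator measurableSet_Iic).comp
    (measurable_pooledStat.comp ?_)
  have : ∀ z : Fin (m + n) → Vec d,
      Fin.append (fun i => z (Fin.castAdd n i)) (fun j => z (Fin.natAdd m j)) = z :=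
    fun z => Fin.append_castAdd_natAdd
  simp only [this]
  exact measurable_pi_lambda _ fun i => measurable_pi_apply _

end Test

/-! ### Means of squared distances and inner products -/

section Moments

variable {d : ℕ}

theorem integral_norm_sq_eq (P : Measure (Vec d)) [IsProbabilityMeasure P]
    (hP : MemLp (fun x : Vec d => x) 2 P) :
    ∫ x, ‖x‖ ^ 2 ∂P = (covMat P).trace + ‖meanVec P‖ ^ 2 := by
  have hc : ∀ i, MemLp (fun x : Vec d => x i) 2 P := fun i => hP.eval_piLp i
  simp only [EuclideanSpace.real_norm_sq_eq]
  rw [integral_finsetSum _ fun i _ => (hc i).integrable_sq, Matrix.trace,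
    ← Finset.sum_add_distrib]
  refine Finset.sum_congr rfl fun i _ => ?_
  rw [Matrix.diag_apply, covMat, Matrix.of_apply, covariance_self (hc i).aemeasurable,
    variance_eq_sub (hc i), meanVec, eval_integral_piLp fun i => (hc i).integrable one_le_two]
  simp

theorem integrable_inner_prod {α β : Type*} [MeasurableSpace α] [MeasurableSpace β]
    {P : Measure α} {Q : Measure β} [SFinite P] [SFinite Q] {f : α → Vec d} {g : β → Vec d}
    (hf : Integrable f P) (hg : Integrable g Q) :
    Integrable (fun z : α × β => inner ℝ (f z.1) (g z.2)) (P.prod Q) := by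
  have := hf.op_fst_snd (op := fun x y => innerSL ℝ x y) (by fun_prop)
    ⟨‖innerSL ℝ (E := Vec d)‖, (innerSL ℝ).le_opNorm₂⟩ hg
  simpa using this

theorem integral_inner_prod {α β : Type*} [MeasurableSpace α] [MeasurableSpace β]
    {P : Measure α} {Q : Measure β} [SFinite P] [SFinite Q] {f : α → Vec d} {g : β → Vec d}
    (hf : Integrable f P) (hg : Integrable g Q) :
    ∫ z : α × β, inner ℝ (f z.1) (g z.2) ∂(P.prod Q) =
      inner ℝ (∫ x, f x ∂P) (∫ y, g y ∂Q) := by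
  exact integral_prod_bilin (innerSL ℝ (E := Vec d)) hf hg

theorem integral_norm_sub_sq (P Q : Measure (Vec d)) [IsProbabilityMeasure P]
    [IsProbabilityMeasure Q] (hP : MemLp (fun x : Vec d => x) 2 P)
    (hQ : MemLp (fun x : Vec d => x) 2 Q) :
    ∫ z : Vec d × Vec d, ‖z.1 - z.2‖ ^ 2 ∂(P.prod Q) =
      (covMat P).trace + (covMat Q).trace + ‖meanVec P - meanVec Q‖ ^ 2 := by
  have hP1 := hP.integrable one_le_two
  have hQ1 := hQ.integrable one_le_two
  have hP2 : Integrable (fun z : Vec d × Vec d => ‖z.1‖ ^ 2) (P.prod Q) :=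
    (hP.integrable_norm_pow two_ne_zero).comp_fst Q
  have hQ2 : Integrable (fun z : Vec d × Vec d => ‖z.2‖ ^ 2) (P.prod Q) :=
    (hQ.integrable_norm_pow two_ne_zero).comp_snd P
  have hPQ := (integrable_inner_prod hP1 hQ1).const_mul 2
  have hPPQ : Integrable (fun z : Vec d × Vec d => ‖z.1‖ ^ 2 - 2 * inner ℝ z.1 z.2) (P.prod Q) :=
    hP2.sub hPQ
  simp only [norm_sub_sq_real]
  rw [integral_add hPPQ hQ2, integral_sub hP2 hPQ, integral_const_mul,
    integral_inner_prod hP1 hQ1, integral_fun_fst (fun x : Vec d => ‖x‖ ^ 2),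
    integral_fun_snd (fun x : Vec d => ‖x‖ ^ 2), integral_norm_sq_eq P hP,
    integral_norm_sq_eq Q hQ]
  simp only [probReal_univ, one_smul, meanVec]
  ring

theorem integral_inner_sub_sub (P Q S : Measure (Vec d)) [IsProbabilityMeasure P]
    [IsProbabilityMeasure Q] [IsProbabilityMeasure S] (hP : MemLp (fun x : Vec d => x) 2 P)
    (hQ : MemLp (fun x : Vec d => x) 2 Q) (hS : MemLp (fun x : Vec d => x) 2 S) :
    ∫ z : Vec d × Vec d × Vec d, inner ℝ (z.1 - z.2.2) (z.2.1 - z.2.2) ∂(P.prod (Q.prod S)) =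
      (covMat S).trace + inner ℝ (meanVec P - meanVec S) (meanVec Q - meanVec S) := by
  have hP1 := hP.integrable one_le_two
  have hQ1 := hQ.integrable one_le_two
  have hS1 := hS.integrable one_le_two
  have hS2 : Integrable (fun z : Vec d × Vec d => ‖z.2‖ ^ 2) (Q.prod S) :=
    (hS.integrable_norm_pow two_ne_zero).comp_snd Q
  have hQ3 : Integrable (fun z : Vec d × Vec d => z.1) (Q.prod S) := hQ1.comp_fst S
  have hS3 : Integrable (fun z : Vec d × Vec d => z.2) (Q.prod S) := hS1.comp_snd Q
  have hQR := integrable_inner_prod hQ1 hS1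
  have hg : Integrable (fun w : Vec d × Vec d => w.1 - w.2) (Q.prod S) := hQ3.sub hS3
  have hh : Integrable (fun w : Vec d × Vec d => ‖w.2‖ ^ 2 - inner ℝ w.1 w.2) (Q.prod S) :=
    hS2.sub hQR
  have e : ∀ z : Vec d × Vec d × Vec d, inner ℝ (z.1 - z.2.2) (z.2.1 - z.2.2) =
      inner ℝ z.1 (z.2.1 - z.2.2) + (‖z.2.2‖ ^ 2 - inner ℝ z.2.1 z.2.2) := by
    intro z
    rw [inner_sub_left, ← real_inner_self_eq_norm_sq, inner_sub_right z.2.2,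
      real_inner_comm z.2.1]
    ring
  simp only [e]
  rw [integral_add (integrable_inner_prod hP1 hg) (hh.comp_snd P),
    integral_inner_prod hP1 hg,
    integral_fun_snd (fun w : Vec d × Vec d => ‖w.2‖ ^ 2 - inner ℝ w.1 w.2),
    integral_sub hS2 hQR, integral_inner_prod hQ1 hS1, integral_sub hQ3 hS3,
    integral_fun_fst (fun x : Vec d => x), integral_fun_snd (fun x : Vec d => x),
    integral_fun_snd (fun x : Vec d => ‖x‖ ^ 2), integral_norm_sq_eq S hS]
  simp only [probReal_univ, one_smul, meanVec, inner_sub_left, inner_sub_right,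
    ← real_inner_self_eq_norm_sq]
  rw [real_inner_comm (∫ x : Vec d, x ∂S) (∫ x : Vec d, x ∂P),
    real_inner_comm (∫ x : Vec d, x ∂S) (∫ x : Vec d, x ∂Q)]
  ring

end Moments

/-! ### Concentration -/

/-- Once the normalised mean is within `η/2` of `L`, a deviation `η` requires `f d` to leave its
mean by `η d / 2`. Chebyshev with variance at most `C d` bounds this probability by `C / ((η/2)²
d)`. -/
theorem tendsto_measure_dev {Ω E : ℕ → Type*} [∀ d, MeasurableSpace (Ω d)]
    [∀ d, MeasurableSpace (E d)] {μ : ∀ d, Measure (Ω d)} {ν : ∀ d, Measure (E d)}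
    [∀ d, IsProbabilityMeasure (ν d)] {Z : ∀ d, Ω d → E d} (hZ : ∀ d, HasLaw (Z d) (ν d) (μ d))
    {f : ∀ d, E d → ℝ} (hf : ∀ d, Measurable (f d)) {C : ℝ≥0}
    (hC : ∀ᶠ d : ℕ in atTop, evariance (f d) (ν d) ≤ (C : ℝ≥0∞) * (d : ℝ≥0∞)) {L : ℝ}
    (hL : Tendsto (fun d : ℕ => (∫ z, f d z ∂(ν d)) / (d : ℝ)) atTop (𝓝 L)) {η : ℝ}
    (hη : 0 < η) :
    Tendsto (fun d : ℕ => μ d {ω | η ≤ |f d (Z d ω) / (d : ℝ) - L|}) atTop (𝓝 0) := by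
  have hbound : ∀ᶠ d : ℕ in atTop, μ d {ω | η ≤ |f d (Z d ω) / (d : ℝ) - L|} ≤
      ENNReal.ofReal (C / (η / 2) ^ 2 / d) := by
    filter_upwards [hC, hL (Metric.ball_mem_nhds L (half_pos hη)), eventually_gt_atTop 0]
      with d hCd hLd hd
    have hd' : (0 : ℝ) < d := by exact_mod_cast hd
    rw [Set.mem_preimage, Metric.mem_ball, Real.dist_eq] at hLd
    have hc : 0 < η / 2 * d := by positivity
    rw [(hZ d).measure_eq (p := fun z => η ≤ |f d z / (d : ℝ) - L|)
      (measurableSet_le measurable_const (((hf d).div_const _).sub_const _).abs)]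
    have hsub : {z | η ≤ |f d z / (d : ℝ) - L|} ⊆
        {z | ((η / 2 * d).toNNReal : ℝ) ≤ |f d z - ∫ z, f d z ∂(ν d)|} := by
      intro z hz
      simp only [Set.mem_ofPred_eq, Real.coe_toNNReal _ hc.le] at hz ⊢
      have h1 := abs_sub_le (f d z / d) ((∫ z, f d z ∂(ν d)) / d) L
      rw [← sub_div, abs_div, abs_of_pos hd'] at h1
      rw [← le_div_iff₀ hd']
      linarith
    refine (measure_mono hsub).trans ((meas_ge_le_evariance_div_sq (hf d).aestronglyMeasurable
      (by simpa using hc)).trans ?_)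
    have : ENNReal.ofReal (C / (η / 2) ^ 2 / d) =
        ((C : ℝ≥0∞) * (d : ℝ≥0∞)) / ((η / 2 * d).toNNReal : ℝ≥0∞) ^ 2 := by
      have e : (C : ℝ) / (η / 2) ^ 2 / d = C * d / (η / 2 * d) ^ 2 := by field_simp
      rw [e, ENNReal.ofReal_div_of_pos (by positivity), ENNReal.ofReal_mul (by positivity),
        ENNReal.ofReal_pow hc.le]
      simp [ENNReal.ofReal]
    rw [this]
    gcongr
  refine tendsto_of_tendsto_of_tendsto_of_le_of_le' tendsto_const_nhds ?_
    (Eventually.of_forall fun _ => zero_le) hbound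
  rw [← ENNReal.ofReal_zero]
  exact ENNReal.tendsto_ofReal (tendsto_const_div_atTop_nhds_zero_nat _)

/-! ### The statistic as a function of the Gram array -/

/-- The angle at the vertex `k` computed from the array of inner products of differences. -/
noncomputable def gramAngle {ι : Type*} (G : ι → ι → ι → ℝ) (i j k : ι) : ℝ :=
  Real.arccos (G i j k / (√(G i i k) * √(G j j k)))

/-- The statistic of the relabelled pooled sample, computed from the array of inner products of
differences. -/
noncomputable def gramStat {m n : ℕ} (G : Fin (m + n) → Fin (m + n) → Fin (m + n) → ℝ)
    (ϖ : Equiv.Perm (Fin (m + n))) : ℝ :=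
  1 / ((m.descFactorial 2 : ℝ) * (n.descFactorial 2 : ℝ)) *
    ∑ i ∈ (Finset.univ : Finset (Fin m)).offDiag, ∑ j ∈ (Finset.univ : Finset (Fin n)).offDiag,
      (1 / 3 - 1 / (2 * Real.pi) * gramAngle G (ϖ (Fin.castAdd n i.1)) (ϖ (Fin.castAdd n i.2))
          (ϖ (Fin.natAdd m j.1))
        - 1 / (2 * Real.pi) * gramAngle G (ϖ (Fin.natAdd m j.1)) (ϖ (Fin.natAdd m j.2))
          (ϖ (Fin.castAdd n i.1)))

/-- The array of normalised inner products of differences. -/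
noncomputable def gram {d : ℕ} {ι : Type*} (z : ι → Vec d) (i j k : ι) : ℝ :=
  inner ℝ (z i - z k) (z j - z k) / (d : ℝ)

/-- Angles are scale invariant, so the factor `1/d` cancels; coinciding points also agree, both
sides being `arccos 0`. -/
theorem gramAngle_gram {d : ℕ} (hd : 0 < d) {ι : Type*} (z : ι → Vec d) (i j k : ι) :
    gramAngle (gram z) i j k = InnerProductGeometry.angle (z i - z k) (z j - z k) := by
  have hd' : (0 : ℝ) < d := by exact_mod_cast hd
  unfold gramAngle gram InnerProductGeometry.angle
  rw [real_inner_self_eq_norm_sq, real_inner_self_eq_norm_sq, Real.sqrt_div (by positivity),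
    Real.sqrt_div (by positivity), Real.sqrt_sq (norm_nonneg _), Real.sqrt_sq (norm_nonneg _),
    div_mul_div_comm, Real.mul_self_sqrt hd'.le, div_div_div_cancel_right₀ hd'.ne']

theorem pooledStat_comp_perm {d m n : ℕ} (hd : 0 < d) (z : Fin (m + n) → Vec d)
    (ϖ : Equiv.Perm (Fin (m + n))) : pooledStat m n (z ∘ ϖ) = gramStat (gram z) ϖ := by
  simp only [pooledStat, cvmStat, gramStat, kernel, gramAngle_gram hd, Function.comp_apply]

/-- The limit of the array of normalised inner products of differences. -/
noncomputable def limGram (s : Bool → ℝ) (δ : ℝ) {ι : Type*} [DecidableEq ι] (l : ι → Bool)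
    (i j k : ι) : ℝ :=
  if i = k ∨ j = k then 0
  else if i = j then limSq s δ (l i) (l k) else limInner s δ (l i) (l j) (l k)

section LimGram

variable {s : Bool → ℝ} {δ : ℝ} {ι : Type*} [DecidableEq ι] (l : ι → Bool)

theorem limGram_self {i k : ι} (h : i ≠ k) : limGram s δ l i i k = limSq s δ (l i) (l k) := by
  simp [limGram, h]

theorem gramAngle_limGram {i j k : ι} (hij : i ≠ j) (hik : i ≠ k) (hjk : j ≠ k) :
    gramAngle (limGram s δ l) i j k = limAngle s δ (l i) (l j) (l k) := by
  rw [gramAngle, limGram_self l hik, limGram_self l hjk]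
  simp [limGram, limAngle, hij, hik, hjk]

theorem continuousAt_gramAngle (hs : ∀ b, 0 < s b) (hδ : 0 ≤ δ) {i j k : ι} (hik : i ≠ k)
    (hjk : j ≠ k) :
    ContinuousAt (fun G : ι → ι → ι → ℝ => gramAngle G i j k) (limGram s δ l) := by
  have hc : ∀ a b c : ι, Continuous fun G : ι → ι → ι → ℝ => G a b c := fun a b c => by fun_prop
  refine Real.continuous_arccos.continuousAt.comp (ContinuousAt.div (hc i j k).continuousAt
    ((Real.continuous_sqrt.comp (hc i i k)).mul
      (Real.continuous_sqrt.comp (hc j j k))).continuousAt ?_)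
  -- Continuity needs only nonvanishing limiting distances, which hold off the vertex.
  simp only [limGram_self l hik, limGram_self l hjk]
  have h1 := Real.sqrt_pos.2 (limSq_pos hs hδ (l i) (l k))
  have h2 := Real.sqrt_pos.2 (limSq_pos hs hδ (l j) (l k))
  positivity

end LimGram

theorem castAdd_ne_natAdd {m n : ℕ} (i : Fin m) (j : Fin n) : Fin.castAdd n i ≠ Fin.natAdd m j := by
  intro h
  simpa using congrArg (label m n) h

section Stat

variable {s : Bool → ℝ} {δ : ℝ} {m n : ℕ}

theorem gramStat_limGram (ϖ : Equiv.Perm (Fin (m + n))) :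
    gramStat (limGram s δ (label m n)) ϖ =
      limStat s δ (fun i => label m n (ϖ (Fin.castAdd n i)))
        (fun j => label m n (ϖ (Fin.natAdd m j))) := by
  unfold gramStat limStat limKernel
  congr 1
  refine Finset.sum_congr rfl fun i hi => Finset.sum_congr rfl fun j hj => ?_
  have hi' : i.1 ≠ i.2 := by simpa using hi
  have hj' : j.1 ≠ j.2 := by simpa using hj
  have h1 : ∀ a b, ϖ (Fin.castAdd n a) ≠ ϖ (Fin.natAdd m b) := fun a b =>
    ϖ.injective.ne (castAdd_ne_natAdd a b)
  rw [gramAngle_limGram _ (ϖ.injective.ne ((Fin.castAdd_injective m n).ne hi')) (h1 _ _) (h1 _ _),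
    gramAngle_limGram _ (ϖ.injective.ne ((Fin.natAdd_injective n m).ne hj')) (h1 _ _).symm
      (h1 _ _).symm]

theorem continuousAt_gramStat (hs : ∀ b, 0 < s b) (hδ : 0 ≤ δ) (ϖ : Equiv.Perm (Fin (m + n))) :
    ContinuousAt (fun G => gramStat G ϖ) (limGram s δ (label m n)) := by
  have h1 : ∀ a b, ϖ (Fin.castAdd n a) ≠ ϖ (Fin.natAdd m b) := fun a b =>
    ϖ.injective.ne (castAdd_ne_natAdd a b)
  unfold gramStat
  refine continuousAt_const.mul (tendsto_finsetSum _ fun i _ => tendsto_finsetSum _ fun j _ => ?_)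
  exact (continuousAt_const.sub (continuousAt_const.mul
    (continuousAt_gramAngle _ hs hδ (h1 _ _) (h1 _ _)))).sub (continuousAt_const.mul
    (continuousAt_gramAngle _ hs hδ (h1 _ _).symm (h1 _ _).symm))

theorem eventually_gramStat_lt (hs : ∀ b, 0 < s b) (hδ : 0 ≤ δ)
    (hdiff : s true ≠ s false ∨ 0 < δ) (hm : 2 ≤ m) (hn : 2 ≤ n) :
    ∀ᶠ G in 𝓝 (limGram s δ (label m n)),
      ∀ ϖ ∉ separating m n, gramStat G ϖ < gramStat G 1 := by
  refine eventually_all.2 fun ϖ => ?_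
  by_cases hϖ : ϖ ∈ separating m n
  · simp [hϖ]
  have hlt : gramStat (limGram s δ (label m n)) ϖ < gramStat (limGram s δ (label m n)) 1 := by
    simp only [gramStat_limGram, Equiv.Perm.coe_one, id_eq, label_castAdd, label_natAdd]
    simp only [separating, Finset.mem_filter, Finset.mem_univ, true_and, not_forall,
      not_not] at hϖ
    obtain ⟨i, j, h⟩ := hϖ
    exact limStat_lt hs hδ hdiff hm hn _ _ h
  filter_upwards [(continuousAt_gramStat hs hδ ϖ).eventually_lt
    (continuousAt_gramStat hs hδ 1) hlt] with G hG _ using hG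

/-- The strict inequalities at the limit persist on a sup-norm ball, which turns the probabilistic
part into entrywise deviation bounds with one `η`. -/
theorem exists_forall_gramStat_lt (hs : ∀ b, 0 < s b) (hδ : 0 ≤ δ)
    (hdiff : s true ≠ s false ∨ 0 < δ) (hm : 2 ≤ m) (hn : 2 ≤ n) :
    ∃ η > 0, ∀ G : Fin (m + n) → Fin (m + n) → Fin (m + n) → ℝ,
      (∀ i j k, |G i j k - limGram s δ (label m n) i j k| < η) →
        ∀ ϖ ∉ separating m n, gramStat G ϖ < gramStat G 1 := by
  obtain ⟨η, hη, h⟩ := Metric.eventually_nhds_iff.1 (eventually_gramStat_lt hs hδ hdiff hm hn)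
  refine ⟨η, hη, fun G hG => h ?_⟩
  simp only [dist_pi_lt_iff hη, Real.dist_eq]
  exact hG

end Stat

/-! ### Convergence in probability of the Gram array -/

/-- The law of the population with label `b`. -/
noncomputable def pop (PX PY : ∀ d : ℕ, Measure (Vec d)) (b : Bool) : ∀ d : ℕ, Measure (Vec d) :=
  if b then PX else PY

section Prob

variable {PX PY : ∀ d : ℕ, Measure (Vec d)} {sX sY δ : ℝ}

theorem pop_mem (b : Bool) : pop PX PY b ∈ ({PX, PY} : Set (∀ d : ℕ, Measure (Vec d))) := by
  cases b <;> simp [pop]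

instance pop_isProbabilityMeasure [∀ d, IsProbabilityMeasure (PX d)]
    [∀ d, IsProbabilityMeasure (PY d)] (b : Bool) (d : ℕ) :
    IsProbabilityMeasure (pop PX PY b d) := by
  cases b
  · exact inferInstanceAs (IsProbabilityMeasure (PY d))
  · exact inferInstanceAs (IsProbabilityMeasure (PX d))

theorem tendsto_trace (h : ScaleLimits PX PY sX sY δ) (b : Bool) :
    Tendsto (fun d : ℕ => (covMat (pop PX PY b d)).trace / (d : ℝ)) atTop
      (𝓝 (if b then sX else sY)) := by
  cases b
  · exact h.2.1
  · exact h.1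

theorem tendsto_norm_mean_sub (h : ScaleLimits PX PY sX sY δ) (p q : Bool) :
    Tendsto (fun d : ℕ => ‖meanVec (pop PX PY p d) - meanVec (pop PX PY q d)‖ ^ 2 / (d : ℝ)) atTop
      (𝓝 (if p = q then 0 else δ)) := by
  cases p <;> cases q <;> simp only [if_true, sub_self, norm_zero, ne_eq, OfNat.ofNat_ne_zero,
    not_false_eq_true, zero_pow, zero_div, tendsto_const_nhds_iff, reduceCtorEq, if_false]
  · simp only [norm_sub_rev (meanVec (pop PX PY false _))]
    exact h.2.2.1
  · exact h.2.2.1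

theorem tendsto_inner_mean_sub (h : ScaleLimits PX PY sX sY δ) (p q v : Bool) :
    Tendsto (fun d : ℕ => inner ℝ (meanVec (pop PX PY p d) - meanVec (pop PX PY v d))
      (meanVec (pop PX PY q d) - meanVec (pop PX PY v d)) / (d : ℝ)) atTop
      (𝓝 (if p ≠ v ∧ q ≠ v then δ else 0)) := by
  by_cases hp : p = v
  · simp [hp]
  by_cases hq : q = v
  · simp [hq]
  have hpq : p = q := by revert p q v; decide
  subst hpq
  simpa [hp, real_inner_self_eq_norm_sq] using tendsto_norm_mean_sub h p v

theorem pop_memLp (hPX : ∀ d, MemLp (fun x : Vec d => x) 2 (PX d))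
    (hPY : ∀ d, MemLp (fun x : Vec d => x) 2 (PY d)) (b : Bool) (d : ℕ) :
    MemLp (fun x : Vec d => x) 2 (pop PX PY b d) := by
  cases b
  · exact hPY d
  · exact hPX d

/-- If the vertex coincides with an endpoint, the entry is identically zero. Otherwise it is a
squared distance or an inner product over three independent points, and its limit comes from the
exact mean. -/
theorem tendsto_measure_gram [∀ d, IsProbabilityMeasure (PX d)]
    [∀ d, IsProbabilityMeasure (PY d)] (hPX : ∀ d, MemLp (fun x : Vec d => x) 2 (PX d))
    (hPY : ∀ d, MemLp (fun x : Vec d => x) 2 (PY d)) (hA1 : WeakDependence PX PY)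
    (hA2 : ScaleLimits PX PY sX sY δ) {Ω : ℕ → Type*} [∀ d, MeasurableSpace (Ω d)]
    {μ : ∀ d, Measure (Ω d)} [∀ d, IsProbabilityMeasure (μ d)]
    {ι : Type*} [DecidableEq ι] {l : ι → Bool} {Z : ∀ d, ι → Ω d → Vec d}
    (hZ : ∀ d i, HasLaw (Z d i) (pop PX PY (l i) d) (μ d))
    (hindep : ∀ d, iIndepFun (Z d) (μ d)) (i j k : ι) {η : ℝ} (hη : 0 < η) :
    Tendsto (fun d : ℕ => μ d {ω | η ≤ |gram (fun a => Z d a ω) i j k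
      - limGram (fun b => if b then sX else sY) δ l i j k|}) atTop (𝓝 0) := by
  by_cases hik : i = k
  · simp [gram, limGram, hik, not_le.2 hη]
  by_cases hjk : j = k
  · simp [gram, limGram, hjk, not_le.2 hη]
  by_cases hij : i = j
  · subst hij
    simp only [limGram_self _ hik, gram, real_inner_self_eq_norm_sq]
    obtain ⟨C, hC⟩ := (hA1 _ (pop_mem (l i)) _ (pop_mem (l k))).1
    refine tendsto_measure_dev (Z := fun d ω => (Z d i ω, Z d k ω))
      (fun d => ((hindep d).indepFun hik).hasLaw_prod (hZ d i) (hZ d k))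
      (f := fun d z => ‖z.1 - z.2‖ ^ 2) (fun d => by fun_prop) hC ?_ hη
    simp only [integral_norm_sub_sq _ _ (pop_memLp hPX hPY _ _) (pop_memLp hPX hPY _ _), add_div]
    exact ((tendsto_trace hA2 _).add (tendsto_trace hA2 _)).add (tendsto_norm_mean_sub hA2 _ _)
  · simp only [limGram, hik, hjk, hij, or_self, if_false, gram]
    obtain ⟨C, hC⟩ := (hA1 _ (pop_mem (l i)) _ (pop_mem (l j))).2 _ (pop_mem (l k))
    have hlaw : ∀ d, HasLaw (fun ω => (Z d i ω, Z d j ω, Z d k ω))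
        ((pop PX PY (l i) d).prod ((pop PX PY (l j) d).prod (pop PX PY (l k) d))) (μ d) :=
      fun d => ((hindep d).indepFun_prodMk₀ (fun a => (hZ d a).aemeasurable) j k i
        (Ne.symm hij) (Ne.symm hik)).symm.hasLaw_prod (hZ d i)
        (((hindep d).indepFun hjk).hasLaw_prod (hZ d j) (hZ d k))
    refine tendsto_measure_dev hlaw (f := fun d z => inner ℝ (z.1 - z.2.2) (z.2.1 - z.2.2))
      (fun d => by fun_prop) hC ?_ hη
    simp only [integral_inner_sub_sub _ _ _ (pop_memLp hPX hPY _ _) (pop_memLp hPX hPY _ _)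
      (pop_memLp hPX hPY _ _), add_div]
    exact (tendsto_trace hA2 _).add (tendsto_inner_mean_sub hA2 _ _ _)

theorem hasLaw_append {d m n : ℕ} {Ω : Type*} [MeasurableSpace Ω] {μ : Measure Ω}
    {X : Fin m → Ω → Vec d} {Y : Fin n → Ω → Vec d} (hX : ∀ i, HasLaw (X i) (PX d) μ)
    (hY : ∀ j, HasLaw (Y j) (PY d) μ) (k : Fin (m + n)) :
    HasLaw (Fin.append X Y k) (pop PX PY (label m n k) d) μ := by
  refine Fin.addCases (fun i => ?_) (fun j => ?_) k
  · simpa [pop] using hX i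
  · simpa [pop] using hY j

end Prob

/-! ### Conclusion -/

theorem card_bound_le {m n : ℕ} {α : ℝ}
    (hα_ne : m ≠ n → 1 / (((m + n)! : ℝ) / ((m ! : ℝ) * (n ! : ℝ))) < α)
    (hα_eq : m = n → 2 / (((m + n)! : ℝ) / ((m ! : ℝ) * (n ! : ℝ))) < α) :
    ((if m = n then 2 * (m ! * n !) else m ! * n ! : ℕ) : ℝ) / (m + n)! ≤ α := by
  split_ifs with h
  · refine le_trans (le_of_eq ?_) (hα_eq h).le
    push_cast
    rw [div_div_eq_mul_div]
  · refine le_trans (le_of_eq ?_) (hα_ne h).le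
    push_cast
    rw [div_div_eq_mul_div, one_mul]

theorem permTest_eq_indicator {d m n : ℕ} (α : ℝ) (x : Fin m → Vec d) (y : Fin n → Vec d) :
    permTest α x y = (rejectionRegion d m n α).indicator (fun _ => (1 : ℝ)) (Fin.append x y) := by
  simp only [permTest, rejectionRegion, Set.indicator, Set.mem_ofPred_eq, Fin.append_left,
    Fin.append_right]

end HDLSS

theorem mainTheorem10
    (m n : ℕ) (hm : 2 ≤ m) (hn : 2 ≤ n)
    (α : ℝ) (hα_lt : α < 1)
    (hα_ne : m ≠ n → 1 / (((m + n)! : ℝ) / ((m ! : ℝ) * (n ! : ℝ))) < α)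
    (hα_eq : m = n → 2 / (((m + n)! : ℝ) / ((m ! : ℝ) * (n ! : ℝ))) < α)
    (PX PY : ∀ d : ℕ, Measure (HDLSS.Vec d))
    [∀ d, IsProbabilityMeasure (PX d)] [∀ d, IsProbabilityMeasure (PY d)]
    (hPX : ∀ d, MemLp (fun x : HDLSS.Vec d => x) 2 (PX d))
    (hPY : ∀ d, MemLp (fun x : HDLSS.Vec d => x) 2 (PY d))
    (sX sY δ : ℝ)
    (hA1 : HDLSS.WeakDependence PX PY)
    (hA2 : HDLSS.ScaleLimits PX PY sX sY δ)
    (hdiff : sX ≠ sY ∨ 0 < δ)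
    {Ω : ℕ → Type*} [∀ d, MeasurableSpace (Ω d)]
    (μ : ∀ d, Measure (Ω d)) [∀ d, IsProbabilityMeasure (μ d)]
    (X : ∀ d, Fin m → Ω d → HDLSS.Vec d) (Y : ∀ d, Fin n → Ω d → HDLSS.Vec d)
    (hX : ∀ d i, HasLaw (X d i) (PX d) (μ d))
    (hY : ∀ d j, HasLaw (Y d j) (PY d) (μ d))
    (hindep : ∀ d, iIndepFun (Fin.append (X d) (Y d)) (μ d)) :
    Tendsto
      (fun d : ℕ =>
        ∫ ω, HDLSS.permTest α (fun i => X d i ω) (fun j => Y d j ω) ∂(μ d))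
      atTop (𝓝 1) := by
  have hα := HDLSS.card_bound_le hα_ne hα_eq
  have h0 : 0 ≤ α := le_trans (by positivity) hα
  set s : Bool → ℝ := fun b => if b then sX else sY with hs_def
  have hs : ∀ b, 0 < s b := by
    intro b
    cases b
    · exact hA2.2.2.2.2.1
    · exact hA2.2.2.2.1
  obtain ⟨η, hη, hstat⟩ := HDLSS.exists_forall_gramStat_lt (m := m) (n := n) hs hA2.2.2.2.2.2
    (by simpa [hs_def] using hdiff) hm hn
  let Z : ∀ d, Fin (m + n) → Ω d → HDLSS.Vec d := fun d => Fin.append (X d) (Y d)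
  have hZ : ∀ d k, HasLaw (Z d k) (HDLSS.pop PX PY (HDLSS.label m n k) d) (μ d) :=
    fun d => HDLSS.hasLaw_append (hX d) (hY d)
  have happ : ∀ d ω, Fin.append (fun i => X d i ω) (fun j => Y d j ω) = fun k => Z d k ω := by
    intro d ω
    funext k
    refine Fin.addCases (fun i => ?_) (fun j => ?_) k <;> simp [Z]
  let bad : ∀ d, Set (Ω d) := fun d => ⋃ i, ⋃ j, ⋃ k, {ω | η ≤ |HDLSS.gram (fun a => Z d a ω) i j k
      - HDLSS.limGram s δ (HDLSS.label m n) i j k|}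
  have hbad : Tendsto (fun d => μ d (bad d)) atTop (𝓝 0) := by
    have hsum : Tendsto (fun d => ∑ i, ∑ j, ∑ k, μ d {ω | η ≤ |HDLSS.gram (fun a => Z d a ω) i j k
        - HDLSS.limGram s δ (HDLSS.label m n) i j k|}) atTop (𝓝 0) := by
      have := tendsto_finsetSum (Finset.univ : Finset (Fin (m + n))) fun i _ =>
        tendsto_finsetSum (Finset.univ : Finset (Fin (m + n))) fun j _ =>
        tendsto_finsetSum (Finset.univ : Finset (Fin (m + n))) fun k _ =>
        HDLSS.tendsto_measure_gram hPX hPY hA1 hA2 hZ hindep i j k hη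
      simpa using this
    refine tendsto_of_tendsto_of_tendsto_of_le_of_le tendsto_const_nhds hsum
      (fun _ => zero_le) fun d => ?_
    refine (measure_iUnion_fintype_le _ _).trans (Finset.sum_le_sum fun i _ => ?_)
    refine (measure_iUnion_fintype_le _ _).trans (Finset.sum_le_sum fun j _ => ?_)
    exact measure_iUnion_fintype_le _ _
  have hmeas : ∀ d, AEMeasurable (fun ω k => Z d k ω) (μ d) := fun d =>
    aemeasurable_pi_lambda _ fun k => (hZ d k).aemeasurable
  let rej : ∀ d, Set (Ω d) := fun d => {ω | (fun k => Z d k ω) ∈ HDLSS.rejectionRegion d m n α}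
  -- The samples are only almost everywhere measurable, so the rejection event is only
  -- null-measurable.
  have hrej : ∀ d, NullMeasurableSet (rej d) (μ d) := fun d =>
    (hmeas d).nullMeasurable (HDLSS.measurableSet_rejectionRegion h0 hα_lt)
  have hint : ∀ d, ∫ ω, HDLSS.permTest α (fun i => X d i ω) (fun j => Y d j ω) ∂(μ d)
      = 1 - (μ d).real (rej d)ᶜ := by
    intro d
    have e : ∀ ω, HDLSS.permTest α (fun i => X d i ω) (fun j => Y d j ω)
        = (rej d).indicator (fun _ => (1 : ℝ)) ω := by
      intro ω
      rw [HDLSS.permTest_eq_indicator, happ]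
      rfl
    simp only [e]
    rw [integral_indicator₀ (hrej d), probReal_compl_eq_one_sub₀ (hrej d)]
    simp
  -- Acceptance forces some Gram entry to be off by `η`; `d = 0` is excluded because the
  -- normalisation divides by `d`.
  have hsub : ∀ d, 0 < d → (rej d)ᶜ ⊆ bad d := by
    intro d hd ω hω
    by_contra hgood
    apply hω
    have hG : ∀ i j k, |HDLSS.gram (fun a => Z d a ω) i j k
        - HDLSS.limGram s δ (HDLSS.label m n) i j k| < η := by
      simpa [bad] using hgood
    have hlt := hstat _ hG
    simp only [← HDLSS.pooledStat_comp_perm hd] at hlt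
    have := HDLSS.critValue_lt_cvmStat (fun i => X d i ω) (fun j => Y d j ω) (by omega) hα_lt hα
      (by rw [← HDLSS.pooledStat_append, happ]; exact hlt)
    simpa [rej, HDLSS.rejectionRegion, Z] using this
  have hlim : Tendsto (fun d => (μ d).real (rej d)ᶜ) atTop (𝓝 0) := by
    have hb : Tendsto (fun d => (μ d).real (bad d)) atTop (𝓝 0) := by
      rw [← ENNReal.toReal_zero]
      exact (ENNReal.tendsto_toReal ENNReal.zero_ne_top).comp hbad
    refine tendsto_of_tendsto_of_tendsto_of_le_of_le' tendsto_const_nhds hb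
      (Eventually.of_forall fun _ => measureReal_nonneg) ?_
    filter_upwards [eventually_gt_atTop 0] with d hd using measureReal_mono (hsub d hd)
  simp only [hint]
  simpa using hlim.const_sub 1
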